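/- Let $G=(V,E,L)$ be a finite graph with loops, where $(V,E)$ is a simple graph and $L=L^+\cup L^-$ is a set of loops, partitioned into plus loops $L^+$ and minus loops $L^-$ (each node carries at most one loop). Define $$\mathrm{QP}(G)=\operatorname{conv}\Big\{z\in\mathbb R^{V\cup E\cup L}:\ z_{ii}\ge z_i^2\ \forall\{i,i\}\in L^+,\ z_{ii}\le z_i^2\ \forall\{i,i\}\in L^-,\ z_{ij}=z_iz_j\ \forall\{i,j\}\in E,\ z_i\in[0,1]\ \forall i\in V\Big\}.$$ A tree decomposition $(\mathcal X,T)$ of $G$ is a finite family $\mathcal X=(X_i)_{i\in I}$ of subsets of $V$, called bags, together with a tree $T$ on $I$, such that (1) $V=\bigcup_i X_i$; (2) every edge $\{u,v\}\in E$ satisfies $u,v\in X_i$ for some $i$; (3) $X_i\cap X_j\subseteq X_k$ whenever $k$ lies on the path from $i$ to $j$ in $T$. Its width is $\omega(\mathcal X)=\max_i|X_i|-1$, and the spread of a node $v$ is $s_v(\mathcal X)=\sum_{i:\,v\in X_i}(|X_i|-1)$. A set $C\subseteq\mathbb R^n$ has an SOC-representable extended formulation if there are $r\ge 0$ and a finite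 system of second-order cone constraints $\|A_kw+b_k\|_2\le c_k^\top w+d_k$ (with real data; linear inequalities being the case where $A_k$ has no rows) in the variables $w=(x,y)\in\mathbb R^{n+r}$ such that $C=\{x:\exists y\in\mathbb R^r,\ (x,y)\text{ satisfies the system}\}$. Its size is the number $n+r$ of variables plus the sum over the constraints of (number of rows of $A_k$) $+1$. **Theorem.** For all constants $c_1,c_2\in\mathbb R$ there is a polynomial $p$ such that the following holds. Let $G=(V,E,L)$ be a finite graph with loops, and let $(\mathcal X,T)$ be a tree decomposition of $G$ such that - (C1) each bag contains at most one node $i$ with $\{i,i\}\in L^+$; - (C2) $\omega(\mathcal X)\le c_1\log|V|$; - (C3) $s_i(\mathcal X)\le c_2\log|V|$ for every node $i$ with $\{i,i\}\in L^+$. (For $V=\emptyset$ we read $\log|V|$ as $0$.) Then $\mathrm{QP}(G)$ has an SOC-representable extended formulation of size at most $p(|V|)$. -/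

import Mathlib

universe u v

/-- A graph `G = (V, E, L)` with signed loops: a simple graph `(V, E)` together with the set of
nodes carrying a plus loop and the (disjoint) set of nodes carrying a minus loop. -/
structure LoopGraph (V : Type*) where
  /-- The loopless graph `(V, E)`. -/
  graph : SimpleGraph V
  /-- The nodes `i` with `{i, i} ∈ L⁺`. -/
  plus : Set V
  /-- The nodes `i` with `{i, i} ∈ L⁻`. -/
  minus : Set V
  disjoint_loops : Disjoint plus minus

namespace LoopGraph

/-- The index set `V ∪ E ∪ L` of the variables `z`. A loop is given by its node. -/
inductive Coord {V : Type*} (G : LoopGraph V)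
  | node (i : V)
  | edge (e : G.graph.edgeSet)
  | loop (i : (G.plus ∪ G.minus : Set V))

/-- The feasible set of the linearized box-constrained quadratic program of `G`. -/
def feasibleSet {V : Type*} (G : LoopGraph V) : Set (G.Coord → ℝ) :=
  {z | (∀ (i : V) (h : i ∈ G.plus), z (.node i) ^ 2 ≤ z (.loop ⟨i, Or.inl h⟩)) ∧
    (∀ (i : V) (h : i ∈ G.minus), z (.loop ⟨i, Or.inr h⟩) ≤ z (.node i) ^ 2) ∧
    (∀ (i j : V) (h : G.graph.Adj i j), z (.edge ⟨s(i, j), h⟩) = z (.node i) * z (.node j)) ∧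
    (∀ i : V, z (.node i) ∈ Set.Icc (0 : ℝ) 1)}

/-- `QP(G)`, a subset of `ℝ^(V ∪ E ∪ L)`. -/
def QP {V : Type*} (G : LoopGraph V) : Set (G.Coord → ℝ) :=
  convexHull ℝ G.feasibleSet

end LoopGraph

/-- A tree decomposition of a simple graph: a finite family of bags indexed by the nodes of a
tree, with the three usual properties. -/
structure TreeDecomposition {V : Type*} [DecidableEq V] (H : SimpleGraph V) (ι : Type*) where
  /-- The tree on the indices of the bags. -/
  tree : SimpleGraph ι
  isTree : tree.IsTree
  /-- The bags. -/
  bag : ι → Finset V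
  exists_mem_bag : ∀ v : V, ∃ i, v ∈ bag i
  exists_edge_bag : ∀ u v : V, H.Adj u v → ∃ i, u ∈ bag i ∧ v ∈ bag i
  inter_subset_of_mem_path : ∀ (i j : ι) (p : tree.Walk i j), p.IsPath →
    ∀ k ∈ p.support, bag i ∩ bag j ⊆ bag k

namespace TreeDecomposition

/-- The width: the size of the largest bag, minus one. -/
def width {V : Type*} [DecidableEq V] {H : SimpleGraph V} {ι : Type*} [Fintype ι]
    (D : TreeDecomposition H ι) : ℤ :=
  ((Finset.univ.sup fun i => (D.bag i).card : ℕ) : ℤ) - 1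

/-- The spread of a node `v`: the sum of `|X| - 1` over all bags `X` containing `v`. The
subtraction never truncates, because each such bag is nonempty. -/
def spread {V : Type*} [DecidableEq V] {H : SimpleGraph V} {ι : Type*} [Fintype ι]
    (D : TreeDecomposition H ι) (v : V) : ℕ :=
  ∑ i with v ∈ D.bag i, ((D.bag i).card - 1)

end TreeDecomposition

/-- A second-order cone constraint `‖A w + b‖₂ ≤ c ⬝ w + d` in the variables `w ∈ ℝ^σ`, where
`A` has `dim` rows. For `dim = 0` it is the linear inequality `0 ≤ c ⬝ w + d`. -/
structure SOCConstraint (σ : Type*) where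
  dim : ℕ
  A : Matrix (Fin dim) σ ℝ
  b : Fin dim → ℝ
  c : σ → ℝ
  d : ℝ

/-- `w` satisfies the second-order cone constraint. -/
def SOCConstraint.Holds {σ : Type*} [Fintype σ] (k : SOCConstraint σ) (w : σ → ℝ) : Prop :=
  ‖WithLp.toLp 2 (k.A.mulVec w + k.b)‖ ≤ k.c ⬝ᵥ w + k.d

/-- The solution set of a finite system of second-order cone constraints. -/
def socSolutionSet {σ : Type*} [Fintype σ] (S : List (SOCConstraint σ)) : Set (σ → ℝ) :=
  {w | ∀ k ∈ S, k.Holds w}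

/-- The size of a finite system of second-order cone constraints: the number of all its variables,
plus the total dimension of its cones (a constraint `‖A w + b‖₂ ≤ c ⬝ w + d` in which `A` has `m`
rows counts `m + 1`). -/
def socSize {σ : Type*} [Fintype σ] (S : List (SOCConstraint σ)) : ℕ :=
  Fintype.card σ + (S.map fun k => k.dim + 1).sum

/-- `Q ⊆ ℝ^(α ⊕ r)` is an extended formulation of `C ⊆ ℝ^α`: it is convex and projects onto
`C`. -/
def IsExtendedFormulation {α : Type*} {r : ℕ} (Q : Set (α ⊕ Fin r → ℝ)) (C : Set (α → ℝ)) : Prop :=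
  Convex ℝ Q ∧ C = {x | ∃ y : Fin r → ℝ, Sum.elim x y ∈ Q}

/-- The index set `V ∪ E ∪ L` is finite if `V` is. -/
noncomputable instance LoopGraph.instFintypeCoord {V : Type*} [Fintype V] (G : LoopGraph V) :
    Fintype G.Coord := by
  classical
  exact Fintype.ofInjective
    (fun x : G.Coord => match x with
      | .node i => (Sum.inl i : V ⊕ Sym2 V ⊕ V)
      | .edge e => Sum.inr (Sum.inl e.1)
      | .loop i => Sum.inr (Sum.inr i.1))
    (by
      rintro (a | a | a) (b | b | b) h <;> simp_all [Subtype.ext_iff])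

/-- The set `C` has an SOC-representable extended formulation of size at most `N`. -/
def HasSOCExtendedFormulation {α : Type*} [Fintype α] (C : Set (α → ℝ)) (N : ℕ) : Prop :=
  ∃ (r : ℕ) (S : List (SOCConstraint (α ⊕ Fin r))),
    IsExtendedFormulation (socSolutionSet S) C ∧ socSize S ≤ N

/-! Call a node plus if it carries a plus loop. The vertices that are not plus nodes may be rounded
to 0/1: their edges see only products, and on $[0,1]$ the constraint $z_{ii}\le z_i^2$ has hull
$z_{ii}\le z_i$, attained at 0/1 up to lowering $z_{ii}$. By (C1) no two plus nodes are adjacent, so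
once the neighbours of a plus node $i$ are fixed, all that remains at $i$ is the convex constraint
$z_{ii}\ge z_i^2$, $z_i\in[0,1]$.

Enlarge each bag by all bags sharing a plus node with it (`mergedBag`). The result still satisfies
the path condition, and a merged bag has at most width + 1 or spread + 1 elements
(`card_mergedBag_le`), hence only polynomially many subsets. Each plus node $i$ now has a set $R_i$
containing all its neighbours.

The formulation has a distribution $\lambda_B$ on the subsets of each set $B$ of the family,
consistent on overlaps, and for each plus node $i$ and $T\subseteq R_i$ variables $y_i(T), w_i(T)$
standing for $\lambda(T)$ times the values of $z_i,z_{ii}$ given $T$, tied by the perspective cone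
$y^2\le\lambda w$. A feasible point lifts through the product distribution (`exists_isLift`), and
convexity extends this to the hull. Conversely, running intersection glues the $\lambda_B$ into one
distribution on vertex sets (`RunningIntersection.exists_glue`); giving each plus node its
conditional mean $y_i/\lambda$ writes $z$ as an average of feasible points (`IsLift.mem_QP`). -/

/-! ### Running intersection families from trees -/

/-- A family of finite sets with the running intersection property: the family can be built up by
adding sets `B` whose intersection with the union of the previous sets lies in one of them. -/
inductive RunningIntersection {V : Type*} [DecidableEq V] : Finset (Finset V) → Prop
  | singleton (B : Finset V) : RunningIntersection {B}
  | insert (B P : Finset V) (F : Finset (Finset V)) (hF : RunningIntersection F) (hP : P ∈ F)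
      (hB : B ∩ F.sup id ⊆ P) : RunningIntersection (Insert.insert B F)

/-- If, for every vertex, the indices of the sets containing it form a subtree, then the maximal
sets can be arranged in a small family with the running intersection property. -/
theorem exists_runningIntersection {V ι : Type*} [Fintype V] [DecidableEq V] [Fintype ι]
    {T : SimpleGraph ι} (hT : T.IsTree) (B : ι → Finset V)
    (hB : ∀ (i j : ι) (p : T.Walk i j), p.IsPath → ∀ k ∈ p.support, B i ∩ B j ⊆ B k) :
    ∃ F : Finset (Finset V), RunningIntersection F ∧ (∀ S ∈ F, ∃ i, S = B i) ∧
      (∀ i, ∃ P ∈ F, B i ⊆ P) ∧ F.card ≤ Fintype.card V + 1 := by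
  classical
  -- Grow a subtree `A` one tree node at a time. Every set after the first is charged to a new
  -- vertex in the union, so `F` stays small however large the tree is; the `+ 1` pays for the first
  -- set, which may be empty.
  have key : ∀ n : ℕ, n + 1 ≤ Fintype.card ι → ∃ A : Finset ι, A.card = n + 1 ∧
      (∀ i ∈ A, ∀ j ∈ A, ∃ p : T.Walk i j, p.IsPath ∧ ∀ k ∈ p.support, k ∈ A) ∧
      ∃ F : Finset (Finset V), RunningIntersection F ∧ (∀ S ∈ F, ∃ i ∈ A, S = B i) ∧
        (∀ i ∈ A, ∃ P ∈ F, B i ⊆ P) ∧ F.card ≤ (F.sup id).card + 1 := by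
    intro n
    induction n with
    | zero =>
      intro _
      obtain ⟨r⟩ := hT.connected.nonempty
      refine ⟨{r}, rfl, ?_, {B r}, .singleton _, ?_, ?_, ?_⟩
      · intro i hi j hj
        obtain rfl := Finset.mem_singleton.1 hi
        obtain rfl := Finset.mem_singleton.1 hj
        exact ⟨.nil, .nil, by simp⟩
      · simp
      · simp
      · simp
    | succ n ih =>
      intro hn
      obtain ⟨A, hAc, hA, F, hF, hFA, hAF, hFc⟩ := ih (by omega)
      obtain ⟨a, ha⟩ : A.Nonempty := Finset.card_pos.1 (by omega)
      obtain ⟨b, hb⟩ : ∃ b, b ∉ A := by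
        by_contra! h
        have : A = Finset.univ := Finset.eq_univ_iff_forall.2 h
        rw [this, Finset.card_univ] at hAc
        omega
      obtain ⟨q⟩ := hT.connected.preconnected a b
      obtain ⟨d, -, hp, hk⟩ := q.exists_boundary_dart (A : Set ι) ha hb
      obtain ⟨⟨p, k⟩, hpk⟩ := d
      simp only [Finset.mem_coe] at hp hk
      -- The new node `k` is attached to `A` through `p`, so the part of `B k` already covered lies
      -- in `B p`.
      have hpath : ∀ l ∈ A, ∃ w : T.Walk k l, w.IsPath ∧ p ∈ w.support ∧
          ∀ m ∈ w.support, m ∈ insert k A := by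
        intro l hl
        obtain ⟨w, hw, hwA⟩ := hA p hp l hl
        refine ⟨.cons hpk.symm w, hw.cons fun h => hk (hwA _ h), by simp, ?_⟩
        intro m hm
        rw [SimpleGraph.Walk.support_cons, List.mem_cons] at hm
        rcases hm with rfl | hm
        · simp
        · exact Finset.mem_insert_of_mem (hwA _ hm)
      have hcard : (insert k A).card = n + 1 + 1 := by rw [Finset.card_insert_of_notMem hk, hAc]
      have hconn : ∀ i ∈ insert k A, ∀ j ∈ insert k A,
          ∃ p : T.Walk i j, p.IsPath ∧ ∀ m ∈ p.support, m ∈ insert k A := by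
        intro i hi j hj
        rcases Finset.mem_insert.1 hi with rfl | hiA <;>
          rcases Finset.mem_insert.1 hj with rfl | hjA
        · exact ⟨.nil, .nil, by simp⟩
        · obtain ⟨w, hw, -, h⟩ := hpath j hjA
          exact ⟨w, hw, h⟩
        · obtain ⟨w, hw, -, h⟩ := hpath i hiA
          exact ⟨w.reverse, hw.reverse, by simpa using h⟩
        · obtain ⟨w, hw, h⟩ := hA i hiA j hjA
          exact ⟨w, hw, fun m hm => Finset.mem_insert_of_mem (h m hm)⟩
      obtain ⟨P, hPF, hpP⟩ := hAF p hp
      have hinter : B k ∩ F.sup id ⊆ P := by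
        intro v hv
        obtain ⟨hv1, hv2⟩ := Finset.mem_inter.1 hv
        obtain ⟨S, hS, hvS⟩ := Finset.mem_sup.1 hv2
        obtain ⟨l, hl, rfl⟩ := hFA S hS
        obtain ⟨w, hw, hpw, -⟩ := hpath l hl
        exact hpP (hB k l w hw p hpw (Finset.mem_inter.2 ⟨hv1, hvS⟩))
      refine ⟨insert k A, hcard, hconn, ?_⟩
      -- A set that brings no new vertex is contained in `P` and can be dropped.
      by_cases hsub : B k ⊆ F.sup id
      · refine ⟨F, hF, fun S hS => ?_, fun i hi => ?_, hFc⟩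
        · obtain ⟨i, hi, h⟩ := hFA S hS
          exact ⟨i, Finset.mem_insert_of_mem hi, h⟩
        · rcases Finset.mem_insert.1 hi with rfl | hi
          · exact ⟨P, hPF, (Finset.subset_inter subset_rfl hsub).trans hinter⟩
          · exact hAF i hi
      · refine ⟨insert (B k) F, .insert _ P _ hF hPF hinter, fun S hS => ?_, fun i hi => ?_, ?_⟩
        · rcases Finset.mem_insert.1 hS with rfl | hS
          · exact ⟨k, Finset.mem_insert_self _ _, rfl⟩
          · obtain ⟨i, hi, h⟩ := hFA S hS
            exact ⟨i, Finset.mem_insert_of_mem hi, h⟩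
        · rcases Finset.mem_insert.1 hi with rfl | hi
          · exact ⟨B i, Finset.mem_insert_self _ _, subset_rfl⟩
          · obtain ⟨P, hP, h⟩ := hAF i hi
            exact ⟨P, Finset.mem_insert_of_mem hP, h⟩
        · have hlt : (F.sup id).card < ((insert (B k) F).sup id).card := by
            apply Finset.card_lt_card
            rw [Finset.sup_insert]
            exact Finset.ssubset_iff_subset_ne.2 ⟨Finset.subset_union_right, fun h => hsub
              (h ▸ Finset.subset_union_left)⟩
          have := Finset.card_insert_le (B k) F
          omega
  have hpos : 0 < Fintype.card ι := Fintype.card_pos_iff.2 hT.connected.nonempty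
  obtain ⟨A, hAc, -, F, hF, hFA, hAF, hFc⟩ := key (Fintype.card ι - 1) (by omega)
  have hAu : A = Finset.univ := (Finset.card_eq_iff_eq_univ A).1 (by omega)
  subst hAu
  refine ⟨F, hF, fun S hS => ?_, fun i => hAF i (Finset.mem_univ i), ?_⟩
  · obtain ⟨i, -, h⟩ := hFA S hS
    exact ⟨i, h⟩
  · have := Finset.card_le_univ (F.sup id)
    omega

/-! ### Merging bags around the plus nodes -/

namespace TreeDecomposition

variable {V : Type*} [DecidableEq V] {H : SimpleGraph V} {ι : Type*}

/-- The bag of `i`, enlarged by all the bags that share a vertex of `S` with it. -/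
noncomputable def mergedBag [Fintype ι] (D : TreeDecomposition H ι) (S : Set V) (i : ι) :
    Finset V := by
  classical
  exact D.bag i ∪ Finset.univ.biUnion fun j =>
    if ∃ s ∈ S, s ∈ D.bag i ∧ s ∈ D.bag j then D.bag j else ∅

theorem mem_mergedBag [Fintype ι] (D : TreeDecomposition H ι) (S : Set V) (i : ι) (v : V) :
    v ∈ D.mergedBag S i ↔
      v ∈ D.bag i ∨ ∃ s ∈ S, s ∈ D.bag i ∧ ∃ j, s ∈ D.bag j ∧ v ∈ D.bag j := by
  classical
  simp only [mergedBag, Finset.mem_union, Finset.mem_biUnion, Finset.mem_univ, true_and]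
  refine or_congr_right ⟨?_, ?_⟩
  · rintro ⟨j, hj⟩
    split_ifs at hj with h
    · obtain ⟨s, hs, h1, h2⟩ := h
      exact ⟨s, hs, h1, j, h2, hj⟩
    · simp at hj
  · rintro ⟨s, hs, h1, j, h2, hj⟩
    exact ⟨j, by rwa [if_pos ⟨s, hs, h1, h2⟩]⟩

/-- The nodes whose merged bag contains `v` are connected: they form the subtree of `v` together
with the subtrees of those `s ∈ S` that share a bag with `v`, each of which meets it. A walk inside
this set contains the unique tree path. -/
theorem mergedBag_inter_subset [Fintype ι] (D : TreeDecomposition H ι) (S : Set V) (i j : ι)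
    (p : D.tree.Walk i j) (hp : p.IsPath) (k : ι) (hk : k ∈ p.support) :
    D.mergedBag S i ∩ D.mergedBag S j ⊆ D.mergedBag S k := by
  classical
  intro v hv
  obtain ⟨hvi, hvj⟩ := Finset.mem_inter.1 hv
  have conn : ∀ (w : V) (a b : ι), w ∈ D.bag a → w ∈ D.bag b →
      ∃ q : D.tree.Walk a b, ∀ m ∈ q.support, w ∈ D.bag m := by
    intro w a b ha hb
    obtain ⟨q⟩ := D.isTree.connected.preconnected a b
    exact ⟨q.bypass, fun m hm => D.inter_subset_of_mem_path a b _ q.bypass_isPath m hm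
      (Finset.mem_inter.2 ⟨ha, hb⟩)⟩
  have reach : ∀ a, v ∈ D.mergedBag S a → ∃ b, v ∈ D.bag b ∧
      ∃ q : D.tree.Walk a b, ∀ m ∈ q.support, v ∈ D.mergedBag S m := by
    intro a ha
    rcases (D.mem_mergedBag S a v).1 ha with h | ⟨s, hs, hsa, b, hsb, hvb⟩
    · exact ⟨a, h, .nil, by simpa using ha⟩
    · obtain ⟨q, hq⟩ := conn s a b hsa hsb
      exact ⟨b, hvb, q, fun m hm =>
        (D.mem_mergedBag S m v).2 (Or.inr ⟨s, hs, hq m hm, b, hsb, hvb⟩)⟩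
  obtain ⟨a, ha, q₁, h₁⟩ := reach i hvi
  obtain ⟨b, hb, q₃, h₃⟩ := reach j hvj
  obtain ⟨q₂, h₂⟩ := conn v a b ha hb
  set q := q₁.append (q₂.append q₃.reverse) with hq
  have hqm : ∀ m ∈ q.support, v ∈ D.mergedBag S m := by
    intro m hm
    rw [hq, SimpleGraph.Walk.mem_support_append_iff, SimpleGraph.Walk.mem_support_append_iff,
      SimpleGraph.Walk.support_reverse, List.mem_reverse] at hm
    rcases hm with h | h | h
    · exact h₁ m h
    · exact (D.mem_mergedBag S m v).2 (Or.inl (h₂ m h))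
    · exact h₃ m h
  have heq : p = q.bypass := D.isTree.existsUnique_path i j |>.unique hp q.bypass_isPath
  subst heq
  exact hqm k (q.support_bypass_subset_support hk)

/-- If the bag contains some `s ∈ S`, then `s` is the only one, so exactly the bags through `s` are
merged. Counting `s` once and the other elements of each bag separately gives spread + 1. -/
theorem card_mergedBag_le [Fintype ι] (D : TreeDecomposition H ι) (S : Set V)
    (hS : ∀ i : ι, ∀ u ∈ D.bag i, ∀ v ∈ D.bag i, u ∈ S → v ∈ S → u = v) (i : ι) :
    ((D.mergedBag S i).card : ℤ) ≤ D.width + 1 ∨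
      ∃ s ∈ S, (D.mergedBag S i).card ≤ D.spread s + 1 := by
  classical
  by_cases h : ∃ s ∈ S, s ∈ D.bag i
  · right
    obtain ⟨s, hs, hsi⟩ := h
    refine ⟨s, hs, ?_⟩
    have hsub : D.mergedBag S i ⊆
        insert s ((Finset.univ.filter fun j => s ∈ D.bag j).biUnion fun j => (D.bag j).erase s) := by
      intro v hv
      obtain ⟨j, hsj, hvj⟩ : ∃ j, s ∈ D.bag j ∧ v ∈ D.bag j := by
        rcases (D.mem_mergedBag S i v).1 hv with h | ⟨t, ht, hti, j, htj, hvj⟩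
        · exact ⟨i, hsi, h⟩
        · obtain rfl := hS i t hti s hsi ht hs
          exact ⟨j, htj, hvj⟩
      by_cases hvs : v = s
      · simp [hvs]
      · simp only [Finset.mem_insert, Finset.mem_biUnion, Finset.mem_filter, Finset.mem_univ,
          true_and, Finset.mem_erase]
        exact Or.inr ⟨j, hsj, hvs, hvj⟩
    refine (Finset.card_le_card hsub).trans ((Finset.card_insert_le _ _).trans ?_)
    refine Nat.add_le_add_right (Finset.card_biUnion_le.trans (Finset.sum_le_sum ?_)) 1
    intro j hj
    rw [Finset.card_erase_of_mem (Finset.mem_filter.1 hj).2]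
  · left
    have : D.mergedBag S i = D.bag i := by
      ext v
      rw [mem_mergedBag]
      exact ⟨fun hv => hv.resolve_right fun ⟨s, hs, hsi, _⟩ => h ⟨s, hs, hsi⟩, Or.inl⟩
    rw [this, width, sub_add_cancel]
    exact_mod_cast Finset.le_sup (f := fun i => (D.bag i).card) (Finset.mem_univ i)

end TreeDecomposition

/-! ### Pushforward, coupling and gluing of finite distributions -/

/-- The image of the weights `μ` under the map `f`. -/
noncomputable def pushWeight {α β : Type*} [Fintype α] (f : α → β) (μ : α → ℝ) (b : β) : ℝ := by
  classical
  exact ∑ a, if f a = b then μ a else 0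

section pushWeight

variable {α β γ : Type*} [Fintype α]

theorem sum_mul_pushWeight [Fintype β] (f : α → β) (μ : α → ℝ) (φ : β → ℝ) :
    ∑ b, pushWeight f μ b * φ b = ∑ a, μ a * φ (f a) := by
  classical
  simp only [pushWeight, Finset.sum_mul]
  rw [Finset.sum_comm]
  refine Finset.sum_congr rfl fun a _ => ?_
  simp [ite_mul]

theorem sum_pushWeight [Fintype β] (f : α → β) (μ : α → ℝ) : ∑ b, pushWeight f μ b = ∑ a, μ a := by
  simpa using sum_mul_pushWeight f μ fun _ => 1

theorem pushWeight_pushWeight [Fintype β] (f : α → β) (g : β → γ) (μ : α → ℝ) :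
    pushWeight g (pushWeight f μ) = pushWeight (g ∘ f) μ := by
  classical
  ext c
  have := sum_mul_pushWeight f μ fun b => if g b = c then 1 else 0
  simpa [pushWeight] using this

theorem pushWeight_congr {f g : α → β} {μ : α → ℝ} (h : ∀ a, μ a ≠ 0 → f a = g a) :
    pushWeight f μ = pushWeight g μ := by
  classical
  ext b
  refine Finset.sum_congr rfl fun a _ => ?_
  by_cases ha : μ a = 0
  · simp [ha]
  · rw [h a ha]

theorem pushWeight_id (μ : α → ℝ) : pushWeight id μ = μ := by
  classical
  ext a
  simp [pushWeight]

theorem pushWeight_nonneg (f : α → β) {μ : α → ℝ} (h : ∀ a, 0 ≤ μ a) (b : β) :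
    0 ≤ pushWeight f μ b := by
  classical
  exact Finset.sum_nonneg fun a _ => by split_ifs <;> simp [h]

theorem exists_of_pushWeight_ne_zero {f : α → β} {μ : α → ℝ} {b : β}
    (h : pushWeight f μ b ≠ 0) : ∃ a, f a = b ∧ μ a ≠ 0 := by
  classical
  obtain ⟨a, -, ha⟩ := Finset.exists_ne_zero_of_sum_ne_zero h
  exact ⟨a, by by_contra h; simp [h] at ha, fun h => by simp [h] at ha⟩

theorem eq_zero_of_pushWeight_eq_zero {f : α → β} {μ : α → ℝ} (hμ : ∀ a, 0 ≤ μ a) {a : α}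
    (h : pushWeight f μ (f a) = 0) : μ a = 0 := by
  classical
  have := (Finset.sum_eq_zero_iff_of_nonneg
    (fun i _ => by split_ifs <;> simp [hμ])).1 h a (Finset.mem_univ a)
  simpa using this

/-- Two weights with the same image are the marginals of a weight on the fibre product. -/
theorem exists_coupling [Fintype β] (f : α → γ) (g : β → γ) {μ : α → ℝ} {ν : β → ℝ} (hμ : ∀ a, 0 ≤ μ a)
    (hν : ∀ b, 0 ≤ ν b) (h : pushWeight f μ = pushWeight g ν) :
    ∃ π : α × β → ℝ, (∀ x, 0 ≤ π x) ∧ pushWeight Prod.fst π = μ ∧ pushWeight Prod.snd π = ν ∧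
      ∀ x, π x ≠ 0 → f x.1 = g x.2 ∧ μ x.1 ≠ 0 ∧ ν x.2 ≠ 0 := by
  classical
  -- Conditionally independent coupling given the common image. On a fibre of mass zero the quotient
  -- is 0, as it should be, since all weights there vanish.
  refine ⟨fun x => if f x.1 = g x.2 then μ x.1 * ν x.2 / pushWeight f μ (f x.1) else 0,
    fun x => ?_, ?_, ?_, fun x hx => ?_⟩
  · dsimp only
    split_ifs
    · exact div_nonneg (mul_nonneg (hμ _) (hν _)) (pushWeight_nonneg f hμ _)
    · exact le_rfl
  · ext a
    have h1 : pushWeight g ν (f a) = ∑ b, if f a = g b then ν b else 0 :=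
      Finset.sum_congr rfl fun b _ => by simp only [eq_comm]
    have h2 : pushWeight Prod.fst (fun x : α × β => if f x.1 = g x.2 then
        μ x.1 * ν x.2 / pushWeight f μ (f x.1) else 0) a =
        μ a / pushWeight f μ (f a) * ∑ b, if f a = g b then ν b else 0 := by
      simp only [pushWeight, Fintype.sum_prod_type, Finset.mul_sum]
      rw [Finset.sum_eq_single a (fun a' _ ha' => by simp [ha']) (by simp)]
      exact Finset.sum_congr rfl fun b _ => by simp only [if_true]; split_ifs <;> ring
    rw [h2, ← h1, ← h]
    by_cases h0 : pushWeight f μ (f a) = 0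
    · rw [eq_zero_of_pushWeight_eq_zero hμ h0]
      simp
    · exact div_mul_cancel₀ _ h0
  · ext b
    have h2 : pushWeight Prod.snd (fun x : α × β => if f x.1 = g x.2 then
        μ x.1 * ν x.2 / pushWeight f μ (f x.1) else 0) b =
        ν b / pushWeight f μ (g b) * pushWeight f μ (g b) := by
      conv_rhs => rw [pushWeight, Finset.mul_sum]
      simp only [pushWeight, Fintype.sum_prod_type]
      refine Finset.sum_congr rfl fun a _ => ?_
      rw [Finset.sum_eq_single b (fun b' _ hb' => by simp [hb']) (by simp), if_pos rfl]
      by_cases hab : f a = g b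
      · simp only [hab, if_true]; ring
      · simp [hab]
    rw [h2]
    by_cases h0 : pushWeight f μ (g b) = 0
    · rw [h] at h0
      rw [eq_zero_of_pushWeight_eq_zero hν h0]
      simp
    · exact div_mul_cancel₀ _ h0
  · dsimp only at hx
    split_ifs at hx with hfg
    · exact ⟨hfg, fun h => by simp [h] at hx, fun h => by simp [h] at hx⟩
    · exact absurd rfl hx

end pushWeight

/-- Consistent distributions on the sets of a family with the running intersection property are
the marginals of a common distribution. -/
theorem RunningIntersection.exists_glue {V : Type*} [Fintype V] [DecidableEq V]
    {F : Finset (Finset V)} (hF : RunningIntersection F) (lam : Finset V → Finset V → ℝ)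
    (hnn : ∀ B ∈ F, ∀ T, 0 ≤ lam B T) (hsupp : ∀ B ∈ F, ∀ T, lam B T ≠ 0 → T ⊆ B)
    (hcons : ∀ B ∈ F, ∀ B' ∈ F, pushWeight (· ∩ B') (lam B) = pushWeight (· ∩ B) (lam B')) :
    ∃ μ : Finset V → ℝ, (∀ s, 0 ≤ μ s) ∧ (∀ s, μ s ≠ 0 → s ⊆ F.sup id) ∧
      ∀ B ∈ F, pushWeight (· ∩ B) μ = lam B := by
  induction hF with
  | singleton B =>
    refine ⟨lam B, hnn B (by simp), by simpa using hsupp B, fun B' hB' => ?_⟩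
    obtain rfl := Finset.mem_singleton.1 hB'
    conv_rhs => rw [← pushWeight_id (lam B')]
    exact pushWeight_congr fun T hT => Finset.inter_eq_left.2 (hsupp _ hB' T hT)
  | insert B P F hF hP hB ih =>
    have hFi : ∀ {A}, A ∈ F → A ∈ Insert.insert B F := fun h => Finset.mem_insert_of_mem h
    have hBi : B ∈ Insert.insert B F := Finset.mem_insert_self _ _
    obtain ⟨μ, hμ, hμs, hμF⟩ := ih (fun A hA => hnn A (hFi hA)) (fun A hA => hsupp A (hFi hA))
      (fun A hA A' hA' => hcons A (hFi hA) A' (hFi hA'))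
    have hsub : ∀ A ∈ F, A ⊆ F.sup id := fun A hA => Finset.le_sup (f := id) hA
    -- By running intersection, the overlap of `B` with the earlier sets lies in `P`, so consistency
    -- of `lam B` with `lam P` alone suffices.
    have hpush : pushWeight (· ∩ B) μ = pushWeight (· ∩ F.sup id) (lam B) := by
      calc pushWeight (· ∩ B) μ = pushWeight ((· ∩ B) ∘ (· ∩ P)) μ :=
            pushWeight_congr fun s hs => by
              ext v
              have h1 := @hμs s hs v
              have h2 := @hB v
              simp only [Function.comp, Finset.mem_inter] at *
              tauto
        _ = pushWeight (· ∩ B) (lam P) := by rw [← pushWeight_pushWeight, hμF P hP]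
        _ = pushWeight (· ∩ P) (lam B) := (hcons B hBi P (hFi hP)).symm
        _ = _ := pushWeight_congr fun T hT => by
              ext v
              have h1 := @hsupp B hBi T hT v
              have h2 := @hB v
              have h3 := @hsub P hP v
              simp only [Finset.mem_inter] at *
              tauto
    obtain ⟨π, hπ, hfst, hsnd, hπs⟩ := exists_coupling _ _ hμ (hnn B hBi) hpush
    -- Coupled sets agree on the overlap, so their union has trace `x.2` on `B` and leaves the trace
    -- of `x.1` on each earlier set unchanged.
    refine ⟨pushWeight (fun x => x.1 ∪ x.2) π, pushWeight_nonneg _ hπ, fun s hs => ?_,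
      fun A hA => ?_⟩
    · obtain ⟨x, rfl, hx⟩ := exists_of_pushWeight_ne_zero hs
      obtain ⟨-, h1, h2⟩ := hπs x hx
      rw [Finset.sup_insert]
      exact Finset.union_subset ((hμs _ h1).trans Finset.subset_union_right)
        ((hsupp B hBi _ h2).trans Finset.subset_union_left)
    · rw [pushWeight_pushWeight]
      by_cases hAB : A = B
      · subst hAB
        rw [← hsnd]
        refine pushWeight_congr fun x hx => ?_
        obtain ⟨h0, -, h2⟩ := hπs x hx
        have h2 := hsupp A hBi _ h2
        simp only [Function.comp, Finset.union_inter_distrib_right, h0, Finset.inter_eq_left.2 h2]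
        exact Finset.union_eq_right.2 Finset.inter_subset_left
      · have hA := (Finset.mem_insert.1 hA).resolve_left hAB
        rw [← hμF A hA, ← hfst, pushWeight_pushWeight]
        refine pushWeight_congr fun x hx => ?_
        obtain ⟨h0, -, h2⟩ := hπs x hx
        ext v
        have h1 := @hsupp B hBi _ h2 v
        have h3 := @hsub A hA v
        have h4 := Finset.ext_iff.1 h0 v
        simp only [Function.comp, Finset.mem_inter, Finset.mem_union] at *
        tauto

/-! ### The lift: completeness and soundness -/

/-- The product distribution with marginals `x` on the subsets of `V`. -/
def productWeight {V : Type*} [Fintype V] [DecidableEq V] (x : V → ℝ) (s : Finset V) : ℝ :=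
  (∏ j ∈ s, x j) * ∏ j ∈ Finset.univ \ s, (1 - x j)

theorem productWeight_nonneg {V : Type*} [Fintype V] [DecidableEq V] {x : V → ℝ}
    (hx : ∀ i, x i ∈ Set.Icc (0 : ℝ) 1) (s : Finset V) : 0 ≤ productWeight x s :=
  mul_nonneg (Finset.prod_nonneg fun i _ => (hx i).1)
    (Finset.prod_nonneg fun i _ => sub_nonneg.2 (hx i).2)

/-- Expand the product over all `j` of `x j + (1 - x j)`, with the second summand replaced by 0 for
`j ∈ A`: exactly the terms with `A ⊆ s` survive. -/
theorem sum_productWeight_superset {V : Type*} [Fintype V] [DecidableEq V] (x : V → ℝ)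
    (A : Finset V) : ∑ s, productWeight x s * (if A ⊆ s then 1 else 0) = ∏ j ∈ A, x j := by
  have h := Finset.prod_add x (fun j => if j ∈ A then 0 else 1 - x j) Finset.univ
  rw [Finset.powerset_univ] at h
  have h1 : ∏ j, (x j + if j ∈ A then 0 else 1 - x j) = ∏ j ∈ A, x j := by
    rw [← Finset.prod_subset (Finset.subset_univ A)]
    · exact Finset.prod_congr rfl fun j hj => by simp [hj]
    · intro j _ hj
      simp [hj]
  rw [← h1, h]
  refine Finset.sum_congr rfl fun s _ => ?_
  rw [productWeight, mul_assoc]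
  congr 1
  by_cases hA : A ⊆ s
  · rw [if_pos hA, mul_one]
    exact Finset.prod_congr rfl fun j hj =>
      (if_neg fun hjA => (Finset.mem_sdiff.1 hj).2 (hA hjA)).symm
  · obtain ⟨j, hjA, hjs⟩ := Finset.not_subset.1 hA
    rw [if_neg hA, mul_zero]
    symm
    exact Finset.prod_eq_zero (Finset.mem_sdiff.2 ⟨Finset.mem_univ j, hjs⟩) (if_pos hjA)

namespace LoopGraph

variable {V : Type*} [Fintype V] [DecidableEq V]

/-- The constraints of the extended formulation of `QP(G)` built on a family `F` of vertex sets: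
`lam B` is a probability distribution on the subsets of `B ∈ F`, and for a node `i` with a plus
loop, `y i` and `w i` split `zᵢ` and `zᵢᵢ` over the subsets of `R i`. -/
structure IsLift (G : LoopGraph V) (F : Finset (Finset V)) (R : V → Finset V) (z : G.Coord → ℝ)
    (lam : Finset V → Finset V → ℝ) (y w : V → Finset V → ℝ) : Prop where
  lam_nonneg : ∀ B ∈ F, ∀ T ∈ B.powerset, 0 ≤ lam B T
  total : ∀ B ∈ F, ∑ T, lam B T = 1
  consistent : ∀ B ∈ F, ∀ B' ∈ F, ∀ U ∈ (B ∩ B').powerset,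
    pushWeight (· ∩ B') (lam B) U = pushWeight (· ∩ B) (lam B') U
  -- Plus nodes are excluded: whether one belongs to `T` has no bearing on its value.
  node : ∀ j, j ∉ G.plus → ∀ B ∈ F, j ∈ B → z (.node j) = ∑ T, if j ∈ T then lam B T else 0
  edge : ∀ j k (h : G.graph.Adj j k), j ∉ G.plus → k ∉ G.plus → ∀ B ∈ F, j ∈ B → k ∈ B →
    z (.edge ⟨s(j, k), h⟩) = ∑ T, if j ∈ T ∧ k ∈ T then lam B T else 0
  y_nonneg : ∀ i, i ∈ G.plus → ∀ T ∈ (R i).powerset, 0 ≤ y i T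
  y_le : ∀ i, i ∈ G.plus → ∀ T ∈ (R i).powerset, y i T ≤ lam (R i) T
  cone : ∀ i, i ∈ G.plus → ∀ T ∈ (R i).powerset,
    0 ≤ lam (R i) T ∧ 0 ≤ w i T ∧ y i T ^ 2 ≤ lam (R i) T * w i T
  plus_node : ∀ i, i ∈ G.plus → z (.node i) = ∑ T, y i T
  plus_loop : ∀ i (h : i ∈ G.plus), z (.loop ⟨i, Or.inl h⟩) = ∑ T, w i T
  plus_edge : ∀ i j (h : G.graph.Adj i j), i ∈ G.plus →
    z (.edge ⟨s(i, j), h⟩) = ∑ T, if j ∈ T then y i T else 0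
  minus_loop : ∀ i (h : i ∈ G.minus), z (.loop ⟨i, Or.inr h⟩) ≤ z (.node i)

theorem exists_isLift (G : LoopGraph V) (F : Finset (Finset V)) (R : V → Finset V)
    (hR : ∀ i ∈ G.plus, R i ∈ F)
    (hadj : ∀ i j, G.graph.Adj i j → i ∈ G.plus → j ∈ R i)
    {z : G.Coord → ℝ} (hz : z ∈ G.feasibleSet) :
    ∃ lam y w, G.IsLift F R z lam y w ∧ (∀ B T, lam B T ≠ 0 → B ∈ F ∧ T ⊆ B) ∧
      (∀ i T, y i T ≠ 0 → i ∈ G.plus ∧ T ⊆ R i) ∧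
      (∀ i T, w i T ≠ 0 → i ∈ G.plus ∧ T ⊆ R i) := by
  classical
  obtain ⟨hplus, hminus, hedge, hbox⟩ := hz
  set x : V → ℝ := fun i => z (.node i) with hx
  set μ := productWeight x with hμ
  have hμ0 : ∀ s, 0 ≤ μ s := productWeight_nonneg hbox
  set lam : Finset V → Finset V → ℝ := fun B T => if B ∈ F then pushWeight (· ∩ B) μ T else 0
    with hlam
  have hlamF : ∀ B ∈ F, lam B = pushWeight (· ∩ B) μ := fun B hB => by ext T; simp [hlam, hB]
  have hlam0 : ∀ B T, 0 ≤ lam B T := fun B T => by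
    simp only [hlam]; split_ifs
    exacts [pushWeight_nonneg _ hμ0 _, le_rfl]
  have hsupp : ∀ B T, lam B T ≠ 0 → B ∈ F ∧ T ⊆ B := fun B T h => by
    simp only [hlam] at h
    split_ifs at h with hB
    · obtain ⟨s, rfl, -⟩ := exists_of_pushWeight_ne_zero h
      exact ⟨hB, Finset.inter_subset_right⟩
    · exact absurd rfl h
  have hmarg : ∀ B ∈ F, ∀ A ⊆ B, ∑ T, (if A ⊆ T then lam B T else 0) = ∏ j ∈ A, x j := by
    intro B hB A hA
    rw [← sum_productWeight_superset x A, hlamF B hB]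
    have := sum_mul_pushWeight (· ∩ B) μ fun T => if A ⊆ T then 1 else 0
    simp only [mul_ite, mul_one, mul_zero] at this ⊢
    rw [this]
    refine Finset.sum_congr rfl fun s _ => ?_
    simp only [Finset.subset_inter_iff, hA, and_true, hμ]
  have htot : ∀ B ∈ F, ∑ T, lam B T = 1 := fun B hB => by
    simpa using hmarg B hB ∅ (Finset.empty_subset _)
  have hmarg1 : ∀ B ∈ F, ∀ j ∈ B, ∑ T, (if j ∈ T then lam B T else 0) = x j := fun B hB j hj => by
    simpa using hmarg B hB {j} (by simpa using hj)
  have hwn : ∀ i (hi : i ∈ G.plus), 0 ≤ z (.loop ⟨i, Or.inl hi⟩) := fun i hi =>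
    (sq_nonneg _).trans (hplus i hi)
  -- A plus node keeps the values `z i` and `z ii` whatever `T` is; independence of the product
  -- distribution gives the edge equations.
  refine ⟨lam, fun i T => if i ∈ G.plus then x i * lam (R i) T else 0,
    fun i T => if h : i ∈ G.plus then z (.loop ⟨i, Or.inl h⟩) * lam (R i) T else 0,
    ⟨fun B _ T _ => hlam0 B T, htot, fun B hB B' hB' U _ => ?_, fun j _ B hB hj => ?_,
      fun j k h _ _ B hB hj hk => ?_, fun i hi T _ => ?_, fun i hi T _ => ?_, fun i hi T _ => ?_,
      fun i hi => ?_, fun i hi => ?_, fun i j h hi => ?_, fun i hi => ?_⟩, hsupp,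
      fun i T h => ?_, fun i T h => ?_⟩
  · rw [hlamF B hB, hlamF B' hB', pushWeight_pushWeight, pushWeight_pushWeight]
    congr 1
    ext s : 1
    simp only [Function.comp]
    rw [Finset.inter_right_comm]
  · exact (hmarg1 B hB j hj).symm
  · rw [hedge j k h]
    have := hmarg B hB {j, k} (by simp [Finset.insert_subset_iff, hj, hk])
    rw [Finset.prod_pair h.ne] at this
    simpa [Finset.insert_subset_iff] using this.symm
  · simp only [hi, if_true]
    exact mul_nonneg (hbox i).1 (hlam0 _ _)
  · simp only [hi, if_true]
    exact mul_le_of_le_one_left (hlam0 _ _) (hbox i).2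
  · simp only [hi, if_true, dif_pos]
    refine ⟨hlam0 _ _, mul_nonneg (hwn i hi) (hlam0 _ _), ?_⟩
    have := mul_le_mul_of_nonneg_right (hplus i hi) (sq_nonneg (lam (R i) T))
    simp only [hx]
    nlinarith
  · simp only [hi, if_true]
    rw [← Finset.mul_sum, htot _ (hR i hi), mul_one]
  · simp only [hi, dif_pos]
    rw [← Finset.mul_sum, htot _ (hR i hi), mul_one]
  · simp only [hi, if_true]
    rw [hedge i j h]
    change x i * x j = _
    rw [← hmarg1 _ (hR i hi) j (hadj i j h hi), Finset.mul_sum]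
    exact Finset.sum_congr rfl fun T _ => by split_ifs <;> simp
  · have h1 := hminus i hi
    have h2 := hbox i
    nlinarith [h2.1, h2.2]
  · dsimp only at h
    split_ifs at h with hi
    · exact ⟨hi, (hsupp _ _ (right_ne_zero_of_mul h)).2⟩
    · exact absurd rfl h
  · dsimp only at h
    split_ifs at h with hi
    · exact ⟨hi, (hsupp _ _ (right_ne_zero_of_mul h)).2⟩
    · exact absurd rfl h

theorem IsLift.mem_QP {G : LoopGraph V} {F : Finset (Finset V)} {R : V → Finset V}
    (hF : RunningIntersection F) (hR : ∀ i ∈ G.plus, R i ∈ F)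
    (hadj : ∀ i j, G.graph.Adj i j → i ∈ G.plus → j ∈ R i ∧ j ∉ G.plus)
    (hnode : ∀ j, ∃ B ∈ F, j ∈ B)
    (hedge : ∀ j k, G.graph.Adj j k → ∃ B ∈ F, j ∈ B ∧ k ∈ B)
    {z : G.Coord → ℝ} {lam : Finset V → Finset V → ℝ} {y w : V → Finset V → ℝ}
    (h : G.IsLift F R z lam y w) (hlam : ∀ B T, lam B T ≠ 0 → T ⊆ B)
    (hy : ∀ i T, y i T ≠ 0 → T ⊆ R i) (hw : ∀ i T, w i T ≠ 0 → T ⊆ R i) : z ∈ G.QP := by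
  classical
  have hlam0 : ∀ B ∈ F, ∀ T, 0 ≤ lam B T := fun B hB T => by
    by_cases hT : T ⊆ B
    · exact h.lam_nonneg B hB T (Finset.mem_powerset.2 hT)
    · exact (not_imp_comm.1 (hlam B T) hT).ge
  have hcons : ∀ B ∈ F, ∀ B' ∈ F, pushWeight (· ∩ B') (lam B) = pushWeight (· ∩ B) (lam B') := by
    intro B hB B' hB'
    ext U
    by_cases hU : U ⊆ B ∩ B'
    · exact h.consistent B hB B' hB' U (Finset.mem_powerset.2 hU)
    · trans 0
      · by_contra hne
        obtain ⟨T, rfl, hT⟩ := exists_of_pushWeight_ne_zero hne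
        exact hU (Finset.inter_subset_inter_right (hlam _ _ hT))
      · by_contra hne
        obtain ⟨T, rfl, hT⟩ := exists_of_pushWeight_ne_zero (Ne.symm hne)
        rw [Finset.inter_comm B B'] at hU
        exact hU (Finset.inter_subset_inter_right (hlam _ _ hT))
  obtain ⟨μ, hμ0, -, hμ⟩ := hF.exists_glue lam hlam0 (fun B _ => hlam B) hcons
  have havg : ∀ B ∈ F, ∀ φ : Finset V → ℝ, ∑ s, μ s * φ (s ∩ B) = ∑ T, lam B T * φ T :=
    fun B hB φ => by rw [← hμ B hB, sum_mul_pushWeight]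
  have hμ1 : ∑ s, μ s = 1 := by
    have hne : F.Nonempty := by
      cases hF with
      | singleton B => exact Finset.singleton_nonempty B
      | insert B => exact Finset.insert_nonempty _ _
    obtain ⟨B, hB⟩ := hne
    rw [← h.total B hB, ← hμ B hB, sum_pushWeight]
  have hylam : ∀ i ∈ G.plus, ∀ T, 0 ≤ y i T ∧ y i T ≤ lam (R i) T ∧ 0 ≤ w i T ∧
      y i T ^ 2 ≤ lam (R i) T * w i T := by
    intro i hi T
    by_cases hT : T ⊆ R i
    · have hT := Finset.mem_powerset.2 hT
      exact ⟨h.y_nonneg i hi T hT, h.y_le i hi T hT, (h.cone i hi T hT).2⟩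
    · have h1 := not_imp_comm.1 (hlam (R i) T) hT
      have h2 := not_imp_comm.1 (hy i T) hT
      have h3 := not_imp_comm.1 (hw i T) hT
      simp [h1, h2, h3]
  have hy0 : ∀ i ∈ G.plus, ∀ T, lam (R i) T = 0 → y i T = 0 := fun i hi T h0 =>
    le_antisymm ((hylam i hi T).2.1.trans h0.le) (hylam i hi T).1
  -- The part of `w i` on sets of probability zero is lost by conditioning. It is nonnegative, and
  -- raising a plus loop preserves feasibility, so it is added back at every `s`.
  set c : V → ℝ := fun i => ∑ T, if lam (R i) T = 0 then w i T else 0 with hc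
  have hc0 : ∀ i ∈ G.plus, 0 ≤ c i := fun i hi => Finset.sum_nonneg fun T _ => by
    split_ifs
    exacts [(hylam i hi T).2.2.1, le_rfl]
  -- Conditional mean at plus nodes, 0/1 elsewhere. `y ≤ lam` keeps the quotient in `[0,1]`, and
  -- division by zero gives the harmless value 0.
  set v : Finset V → V → ℝ := fun s i =>
    if i ∈ G.plus then y i (s ∩ R i) / lam (R i) (s ∩ R i) else if i ∈ s then 1 else 0 with hv
  have hvplus : ∀ s, ∀ i ∈ G.plus, v s i = y i (s ∩ R i) / lam (R i) (s ∩ R i) :=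
    fun s i hi => by simp [hv, hi]
  have hvnot : ∀ s, ∀ i ∉ G.plus, v s i = if i ∈ s then 1 else 0 := fun s i hi => by simp [hv, hi]
  have hminus : ∀ i ∈ G.minus, i ∉ G.plus := fun i hi hi' =>
    Set.disjoint_left.1 G.disjoint_loops hi' hi
  -- At a minus loop `v s i` equals its square, and the constant shift `z ii - z i` is nonpositive.
  set ζ : Finset V → G.Coord → ℝ := fun s q => match q with
    | .node i => v s i
    | .edge e => (e.1.map (v s)).mul
    | .loop i => if i.1 ∈ G.plus then w i (s ∩ R i) / lam (R i) (s ∩ R i) + c i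
        else v s i + (z (.loop i) - z (.node i)) with hζ
  have hmem : ∀ s, ζ s ∈ G.feasibleSet := by
    intro s
    refine ⟨fun i hi => ?_, fun i hi => ?_, fun i j hij => ?_, fun i => ?_⟩
    · simp only [hζ, hi, if_true, hvplus s i hi]
      obtain ⟨h1, h2, h3, h4⟩ := hylam i hi (s ∩ R i)
      refine le_add_of_le_of_nonneg ?_ (hc0 i hi)
      rcases (h1.trans h2).eq_or_lt with h0 | h0
      · simp [← h0]
      · rw [div_pow, div_le_div_iff₀ (by positivity) h0]
        nlinarith
    · simp only [hζ, hminus i hi, if_false, hvnot s i (hminus i hi)]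
      have := h.minus_loop i hi
      split_ifs <;> linarith
    · simp [hζ]
    · simp only [hζ]
      by_cases hi : i ∈ G.plus
      · obtain ⟨h1, h2, -, -⟩ := hylam i hi (s ∩ R i)
        rw [hvplus s i hi]
        exact ⟨div_nonneg h1 (h1.trans h2), div_le_one_of_le₀ h2 (h1.trans h2)⟩
      · rw [hvnot s i hi]
        split_ifs <;> simp
  have hnodeavg : ∀ j, j ∉ G.plus → ∑ s, μ s * v s j = z (.node j) := by
    intro j hj
    obtain ⟨B, hB, hjB⟩ := hnode j
    have := havg B hB fun T => if j ∈ T then 1 else 0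
    rw [h.node j hj B hB hjB]
    simpa [hvnot _ j hj, hjB] using this
  -- Since `j ∈ R i`, both factors depend only on `s ∩ R i`, so the average is computed from `lam (R
  -- i)`.
  have hplusedge : ∀ i j (hij : G.graph.Adj i j), i ∈ G.plus →
      ∑ s, μ s * (v s i * v s j) = z (.edge ⟨s(i, j), hij⟩) := by
    intro i j hij hi
    obtain ⟨hjR, hj⟩ := hadj i j hij hi
    rw [h.plus_edge i j hij hi]
    have := havg (R i) (hR i hi) fun T => y i T / lam (R i) T * if j ∈ T then 1 else 0
    simp only [hvplus _ i hi, hvnot _ j hj]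
    simp only [Finset.mem_inter, hjR, and_true] at this
    rw [this]
    refine Finset.sum_congr rfl fun T _ => ?_
    by_cases h0 : lam (R i) T = 0
    · simp [h0, hy0 i hi T h0]
    · rw [← mul_assoc, mul_div_cancel₀ _ h0]
      simp
  have hsum : z = ∑ s, μ s • ζ s := by
    ext q
    simp only [Finset.sum_apply, Pi.smul_apply, smul_eq_mul]
    rcases q with i | ⟨e, he⟩ | ⟨i, hi⟩
    · by_cases hi : i ∈ G.plus
      · simp only [hζ, hvplus _ i hi]
        rw [havg (R i) (hR i hi) fun T => y i T / lam (R i) T, h.plus_node i hi]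
        refine Finset.sum_congr rfl fun T _ => ?_
        by_cases h0 : lam (R i) T = 0
        · simp [h0, hy0 i hi T h0]
        · rw [mul_div_cancel₀ _ h0]
      · exact (hnodeavg i hi).symm
    · induction e with
      | h i j =>
        have hij : G.graph.Adj i j := he
        simp only [hζ, Sym2.map_mk, Sym2.mul_mk]
        by_cases hi : i ∈ G.plus
        · exact (hplusedge i j hij hi).symm
        · by_cases hj : j ∈ G.plus
          · have := hplusedge j i hij.symm hj
            simp only [mul_comm (v _ j)] at this
            rw [this]
            congr 2
            exact Subtype.ext Sym2.eq_swap
          · obtain ⟨B, hB, hiB, hjB⟩ := hedge i j hij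
            rw [h.edge i j hij hi hj B hB hiB hjB]
            have := havg B hB fun T => if i ∈ T ∧ j ∈ T then 1 else 0
            simp only [Finset.mem_inter, hiB, hjB, and_true, mul_ite, mul_one, mul_zero] at this
            rw [← this]
            refine Finset.sum_congr rfl fun s _ => ?_
            rw [hvnot s i hi, hvnot s j hj]
            by_cases h1 : i ∈ s <;> by_cases h2 : j ∈ s <;> simp [h1, h2]
    · by_cases hip : i ∈ G.plus
      · simp only [hζ, hip, if_true, mul_add, Finset.sum_add_distrib, ← Finset.sum_mul, hμ1]
        rw [havg (R i) (hR i hip) fun T => w i T / lam (R i) T, h.plus_loop i hip, hc, one_mul,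
          ← Finset.sum_add_distrib]
        refine Finset.sum_congr rfl fun T _ => ?_
        by_cases h0 : lam (R i) T = 0
        · simp [h0]
        · rw [mul_div_cancel₀ _ h0]
          simp [h0]
      · simp only [hζ, hip, if_false, mul_add, Finset.sum_add_distrib, ← Finset.sum_mul, hμ1]
        rw [hnodeavg i hip]
        ring
  rw [hsum]
  exact (convex_convexHull ℝ _).sum_mem (fun s _ => hμ0 s) hμ1
    fun s _ => subset_convexHull ℝ _ (hmem s)

end LoopGraph

/-! ### Calculus of second-order cone systems -/

theorem convex_socSolutionSet {σ : Type*} [Fintype σ] (S : List (SOCConstraint σ)) :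
    Convex ℝ (socSolutionSet S) := by
  intro x hx y hy a b ha hb hab k hk
  have h1 := hx k hk
  have h2 := hy k hk
  unfold SOCConstraint.Holds at *
  have heq : WithLp.toLp 2 (k.A.mulVec (a • x + b • y) + k.b) =
      a • WithLp.toLp 2 (k.A.mulVec x + k.b) + b • WithLp.toLp 2 (k.A.mulVec y + k.b) := by
    rw [← WithLp.toLp_smul, ← WithLp.toLp_smul, ← WithLp.toLp_add, Matrix.mulVec_add,
      Matrix.mulVec_smul, Matrix.mulVec_smul]
    congr 1
    nth_rw 1 [← one_smul ℝ k.b, ← hab]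
    module
  rw [heq, dotProduct_add, dotProduct_smul, dotProduct_smul, smul_eq_mul, smul_eq_mul]
  calc _ ≤ a * ‖WithLp.toLp 2 (k.A.mulVec x + k.b)‖ + b * ‖WithLp.toLp 2 (k.A.mulVec y + k.b)‖ := by
        refine (norm_add_le _ _).trans_eq ?_
        rw [norm_smul, norm_smul, Real.norm_of_nonneg ha, Real.norm_of_nonneg hb]
    _ ≤ a * (k.c ⬝ᵥ x + k.d) + b * (k.c ⬝ᵥ y + k.d) := by gcongr
    _ = _ := by linear_combination k.d * hab

/-- The predicate `P` is described by a system of second-order cone constraints whose cones have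
total dimension at most `N`. -/
def SOCRep {σ : Type*} [Fintype σ] (P : (σ → ℝ) → Prop) (N : ℕ) : Prop :=
  ∃ S : List (SOCConstraint σ), (∀ w, w ∈ socSolutionSet S ↔ P w) ∧
    (S.map fun k => k.dim + 1).sum ≤ N

namespace SOCRep

variable {σ : Type*} [Fintype σ]

theorem true' (N : ℕ) : SOCRep (fun _ : σ → ℝ => True) N :=
  ⟨[], by simp [socSolutionSet], by simp⟩

theorem and {P Q : (σ → ℝ) → Prop} {M N : ℕ} (hP : SOCRep P M) (hQ : SOCRep Q N) :
    SOCRep (fun w => P w ∧ Q w) (M + N) := by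
  obtain ⟨S, hS, hM⟩ := hP
  obtain ⟨S', hS', hN⟩ := hQ
  refine ⟨S ++ S', fun w => ?_, by simpa using Nat.add_le_add hM hN⟩
  change _ ↔ P w ∧ Q w
  rw [← hS, ← hS']
  simp [socSolutionSet, or_imp, forall_and]

theorem forall_prop {p : Prop} {P : p → (σ → ℝ) → Prop} {N : ℕ} (h : ∀ hp, SOCRep (P hp) N) :
    SOCRep (fun w => ∀ hp, P hp w) N := by
  by_cases hp : p
  · simpa [hp] using h hp
  · simpa [hp] using true' N

theorem forall_mem {ι : Type*} {s : Finset ι} {P : ι → (σ → ℝ) → Prop} {M N : ℕ} (hs : s.card ≤ M)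
    (h : ∀ i ∈ s, SOCRep (P i) N) : SOCRep (fun w => ∀ i ∈ s, P i w) (M * N) := by
  classical
  induction s using Finset.induction generalizing M with
  | empty => simpa using true' (M * N)
  | insert a s ha ih =>
    rw [Finset.card_insert_of_notMem ha] at hs
    obtain ⟨m, rfl⟩ : ∃ m, M = m + 1 := ⟨M - 1, by omega⟩
    have := (ih (by omega : s.card ≤ m) fun i hi => h i (Finset.mem_insert_of_mem hi)).and
      (h a (Finset.mem_insert_self _ _))
    rw [Nat.succ_mul]
    simpa [Finset.forall_mem_insert, and_comm] using this

theorem forall_fintype {ι : Type*} [Fintype ι] {P : ι → (σ → ℝ) → Prop} {N : ℕ}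
    (h : ∀ i, SOCRep (P i) N) : SOCRep (fun w => ∀ i, P i w) (Fintype.card ι * N) := by
  simpa using forall_mem (s := Finset.univ) Finset.card_univ.le fun i _ => h i

end SOCRep

section linear

variable {σ : Type*}

theorem IsLinearMap.eq_dotProduct [Fintype σ] [DecidableEq σ] {f : (σ → ℝ) → ℝ}
    (hf : IsLinearMap ℝ f) (w : σ → ℝ) : (fun j => f fun i => if j = i then 1 else 0) ⬝ᵥ w = f w := by
  have := LinearMap.pi_apply_eq_sum_univ hf.mk' w
  simp only [IsLinearMap.mk'_apply] at this
  rw [this]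
  exact Finset.sum_congr rfl fun i _ => mul_comm _ _

theorem isLinearMap_proj (i : σ) : IsLinearMap ℝ fun w : σ → ℝ => w i :=
  ⟨fun _ _ => rfl, fun _ _ => rfl⟩

theorem isLinearMap_zero : IsLinearMap ℝ fun _ : σ → ℝ => (0 : ℝ) :=
  ⟨fun _ _ => by simp, fun _ _ => by simp⟩

theorem isLinearMap_sub {f g : (σ → ℝ) → ℝ} (hf : IsLinearMap ℝ f) (hg : IsLinearMap ℝ g) :
    IsLinearMap ℝ fun w => f w - g w :=
  (hf.mk' - hg.mk').isLinear

theorem isLinearMap_sum {ι : Type*} {s : Finset ι} {f : ι → (σ → ℝ) → ℝ}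
    (hf : ∀ i, IsLinearMap ℝ (f i)) : IsLinearMap ℝ fun w => ∑ i ∈ s, f i w := by
  convert (∑ i ∈ s, (hf i).mk').isLinear using 2 with w
  simp

theorem isLinearMap_ite {p : Prop} [Decidable p] {f : (σ → ℝ) → ℝ} (hf : IsLinearMap ℝ f) :
    IsLinearMap ℝ fun w => if p then f w else 0 := by
  split_ifs
  exacts [hf, isLinearMap_zero]

theorem isLinearMap_pushWeight {α β : Type*} [Fintype α] (φ : α → β) {μ : (σ → ℝ) → α → ℝ}
    (hμ : ∀ a, IsLinearMap ℝ fun u => μ u a) (b : β) :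
    IsLinearMap ℝ fun u => pushWeight φ (μ u) b := by
  classical
  exact isLinearMap_sum fun a => isLinearMap_ite (hμ a)

namespace SOCRep

variable [Fintype σ] {f g h : (σ → ℝ) → ℝ}

theorem add_nonneg (hf : IsLinearMap ℝ f) (d : ℝ) : SOCRep (fun w => 0 ≤ f w + d) 1 := by
  classical
  refine ⟨[⟨0, 0, 0, fun j => f fun i => if j = i then 1 else 0, d⟩], fun w => ?_, by simp⟩
  change _ ↔ 0 ≤ f w + d
  rw [← hf.eq_dotProduct w]
  simp only [socSolutionSet, List.mem_singleton, forall_eq, Set.mem_ofPred_eq,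
    SOCConstraint.Holds, Subsingleton.elim (WithLp.toLp 2 _) (0 : EuclideanSpace ℝ (Fin 0)),
    norm_zero]

theorem nonneg (hf : IsLinearMap ℝ f) : SOCRep (fun w => 0 ≤ f w) 1 := by
  simpa using add_nonneg hf 0

theorem le (hf : IsLinearMap ℝ f) (hg : IsLinearMap ℝ g) : SOCRep (fun w => f w ≤ g w) 1 := by
  simpa using nonneg (isLinearMap_sub hg hf)

theorem eq (hf : IsLinearMap ℝ f) (hg : IsLinearMap ℝ g) : SOCRep (fun w => f w = g w) 2 := by
  simpa [le_antisymm_iff] using (le hf hg).and (le hg hf)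

theorem eq_const (hf : IsLinearMap ℝ f) (d : ℝ) : SOCRep (fun w => f w = d) 2 := by
  have := (add_nonneg (isLinearMap_sub isLinearMap_zero hf) d).and (add_nonneg hf (-d))
  simpa [le_antisymm_iff, ← sub_eq_add_neg] using this

theorem rotated_cone (hf : IsLinearMap ℝ f) (hg : IsLinearMap ℝ g) (hh : IsLinearMap ℝ h) :
    SOCRep (fun w => 0 ≤ f w ∧ 0 ≤ g w ∧ h w ^ 2 ≤ f w * g w) 3 := by
  classical
  set cf := fun j => f fun i => if j = i then 1 else 0 with hcf
  set cg := fun j => g fun i => if j = i then 1 else 0 with hcg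
  set ch := fun j => h fun i => if j = i then 1 else 0 with hch
  -- The constraint `h² ≤ f g` with `f, g ≥ 0` is `‖(2h, f - g)‖ ≤ f + g`.
  refine ⟨[⟨2, Matrix.of ![2 • ch, cf - cg], 0, cf + cg, 0⟩], fun w => ?_, by simp⟩
  have e1 := hf.eq_dotProduct w
  have e2 := hg.eq_dotProduct w
  have e3 := hh.eq_dotProduct w
  simp only [socSolutionSet, List.mem_singleton, forall_eq, Set.mem_ofPred_eq,
    SOCConstraint.Holds, EuclideanSpace.norm_eq, Fin.sum_univ_two, Real.norm_eq_abs, sq_abs,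
    add_zero, add_dotProduct, Matrix.mulVec, Matrix.of_apply, Matrix.cons_val_zero,
    Matrix.cons_val_one, smul_dotProduct, sub_dotProduct, ← hcf, ← hcg, ← hch] at e1 e2 e3 ⊢
  rw [e1, e2, e3, Real.sqrt_le_iff, nsmul_eq_mul, Nat.cast_ofNat]
  constructor
  · rintro ⟨h1, h2⟩
    have h3 : h w ^ 2 ≤ f w * g w := by nlinarith
    refine ⟨?_, ?_, h3⟩ <;> by_contra! h4 <;> nlinarith [sq_nonneg (h w)]
  · rintro ⟨h1, h2, h3⟩
    exact ⟨_root_.add_nonneg h1 h2, by nlinarith⟩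

end SOCRep

end linear

/-! ### Assembling the formulation and counting its size -/

namespace LoopGraph

theorem card_coord_le {V : Type*} [Fintype V] (G : LoopGraph V) :
    Fintype.card G.Coord ≤ 2 * Fintype.card V + Fintype.card V ^ 2 := by
  classical
  have := Fintype.card_le_of_injective
    (fun x : G.Coord => match x with
      | .node i => (Sum.inl i : V ⊕ (V × V) ⊕ V)
      | .edge e => Sum.inr (Sum.inl (Quot.out e.1))
      | .loop i => Sum.inr (Sum.inr i.1))
    (by
      rintro (a | a | a) (b | b | b) h <;> simp_all [Subtype.ext_iff]
      exact (Quot.out_eq a.1).symm.trans ((congrArg (Quot.mk _) h).trans (Quot.out_eq b.1)))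
  simp only [Fintype.card_sum, Fintype.card_prod] at this
  nlinarith

variable {V : Type*} [Fintype V] [DecidableEq V]

/-- A bound for the size of the extended formulation on `n` nodes, where every set of the family
has at most `K` subsets. -/
def sizeBound (n K : ℕ) : ℕ :=
  2 * n + n ^ 2 + ((n + 1) * K + (n * K + n * K)) +
    ((n + 1) * (K * 1) + ((n + 1) * 2 + ((n + 1) * ((n + 1) * (K * 2)) + (n * ((n + 1) * 2) +
      (n * (n * ((n + 1) * 2)) + (n * (K * 1) + (n * (K * 1) + (n * (K * 3) + (n * 2 + (n * 2 +
        (n * (n * 2) + n * 1)))))))))))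

/-- The bound is left unsimplified: its twelve summands count the fields of `IsLift` in order. -/
theorem socRep_isLift {σ : Type*} [Fintype σ] (G : LoopGraph V) {F : Finset (Finset V)}
    {R : V → Finset V} {K : ℕ} (hFc : F.card ≤ Fintype.card V + 1)
    (hK : ∀ B ∈ F, B.powerset.card ≤ K) (hR : ∀ i ∈ G.plus, R i ∈ F)
    {z : (σ → ℝ) → G.Coord → ℝ} {lam : (σ → ℝ) → Finset V → Finset V → ℝ}
    {y w : (σ → ℝ) → V → Finset V → ℝ} (hz : ∀ c, IsLinearMap ℝ fun u => z u c)
    (hlam : ∀ B T, IsLinearMap ℝ fun u => lam u B T) (hy : ∀ i T, IsLinearMap ℝ fun u => y u i T)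
    (hw : ∀ i T, IsLinearMap ℝ fun u => w u i T) :
    SOCRep (fun u => G.IsLift F R (z u) (lam u) (y u) (w u))
      ((Fintype.card V + 1) * (K * 1) + ((Fintype.card V + 1) * 2 +
        ((Fintype.card V + 1) * ((Fintype.card V + 1) * (K * 2)) +
        (Fintype.card V * ((Fintype.card V + 1) * 2) +
        (Fintype.card V * (Fintype.card V * ((Fintype.card V + 1) * 2)) +
        (Fintype.card V * (K * 1) + (Fintype.card V * (K * 1) + (Fintype.card V * (K * 3) +
        (Fintype.card V * 2 + (Fintype.card V * 2 + (Fintype.card V * (Fintype.card V * 2) +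
        Fintype.card V * 1))))))))))) := by
  classical
  have hsum : ∀ {ι : Type _} [Fintype ι] {f : ι → (σ → ℝ) → ℝ}, (∀ i, IsLinearMap ℝ (f i)) →
      IsLinearMap ℝ fun u => ∑ i, f i u := fun hf => isLinearMap_sum hf
  have h := SOCRep.and
    (SOCRep.forall_mem hFc fun B hB => SOCRep.forall_mem (hK B hB) fun T _ =>
      SOCRep.nonneg (hlam B T)) <| SOCRep.and
    (SOCRep.forall_mem hFc fun B _ => SOCRep.eq_const
      (hsum fun T => hlam B T) 1) <| SOCRep.and
    (SOCRep.forall_mem hFc fun B hB => SOCRep.forall_mem hFc fun B' _ => SOCRep.forall_mem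
      ((Finset.card_le_card (Finset.powerset_mono.2 (Finset.inter_subset_left (s₂ := B')))).trans
        (hK B hB)) fun U _ => SOCRep.eq
      (isLinearMap_pushWeight (· ∩ B') (hlam B) U)
      (isLinearMap_pushWeight (· ∩ B) (hlam B') U)) <| SOCRep.and
    (SOCRep.forall_fintype fun j => SOCRep.forall_prop fun (_ : j ∉ G.plus) =>
      SOCRep.forall_mem hFc fun B _ => SOCRep.forall_prop fun (_ : j ∈ B) => SOCRep.eq
      (hz (.node j)) (hsum fun T => isLinearMap_ite (p := j ∈ T) (hlam B T))) <| SOCRep.and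
    (SOCRep.forall_fintype fun j => SOCRep.forall_fintype fun k =>
      SOCRep.forall_prop fun (h : G.graph.Adj j k) => SOCRep.forall_prop fun (_ : j ∉ G.plus) =>
      SOCRep.forall_prop fun (_ : k ∉ G.plus) => SOCRep.forall_mem hFc fun B _ =>
      SOCRep.forall_prop fun (_ : j ∈ B) => SOCRep.forall_prop fun (_ : k ∈ B) => SOCRep.eq
      (hz (.edge ⟨s(j, k), h⟩))
      (hsum fun T => isLinearMap_ite (p := j ∈ T ∧ k ∈ T) (hlam B T))) <| SOCRep.and
    (SOCRep.forall_fintype fun i => SOCRep.forall_prop fun (hi : i ∈ G.plus) =>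
      SOCRep.forall_mem (hK _ (hR i hi)) fun T _ => SOCRep.nonneg (hy i T)) <| SOCRep.and
    (SOCRep.forall_fintype fun i => SOCRep.forall_prop fun (hi : i ∈ G.plus) =>
      SOCRep.forall_mem (hK _ (hR i hi)) fun T _ =>
      SOCRep.le (hy i T) (hlam (R i) T)) <| SOCRep.and
    (SOCRep.forall_fintype fun i => SOCRep.forall_prop fun (hi : i ∈ G.plus) =>
      SOCRep.forall_mem (hK _ (hR i hi)) fun T _ =>
      SOCRep.rotated_cone (hlam (R i) T) (hw i T) (hy i T)) <| SOCRep.and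
    (SOCRep.forall_fintype fun i => SOCRep.forall_prop fun (_ : i ∈ G.plus) =>
      SOCRep.eq (hz (.node i)) (hsum fun T => hy i T)) <| SOCRep.and
    (SOCRep.forall_fintype fun i => SOCRep.forall_prop fun (hi : i ∈ G.plus) =>
      SOCRep.eq (hz (.loop ⟨i, Or.inl hi⟩)) (hsum fun T => hw i T)) <| SOCRep.and
    (SOCRep.forall_fintype fun i => SOCRep.forall_fintype fun j =>
      SOCRep.forall_prop fun (h : G.graph.Adj i j) => SOCRep.forall_prop fun (_ : i ∈ G.plus) =>
      SOCRep.eq (hz (.edge ⟨s(i, j), h⟩))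
      (hsum fun T => isLinearMap_ite (p := j ∈ T) (hy i T)))
    (SOCRep.forall_fintype fun i => SOCRep.forall_prop fun (hi : i ∈ G.minus) =>
      SOCRep.le (hz (.loop ⟨i, Or.inr hi⟩)) (hz (.node i)))
  obtain ⟨S, hS, hN⟩ := h
  refine ⟨S, fun u => (hS u).trans ⟨?_, ?_⟩, hN⟩
  · rintro ⟨h1, h2, h3, h4, h5, h6, h7, h8, h9, h10, h11, h12⟩
    exact ⟨h1, h2, h3, h4, h5, h6, h7, h8, h9, h10, h11, h12⟩
  · rintro ⟨h1, h2, h3, h4, h5, h6, h7, h8, h9, h10, h11, h12⟩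
    exact ⟨h1, h2, h3, h4, h5, h6, h7, h8, h9, h10, h11, h12⟩

theorem hasSOCExtendedFormulation_QP (G : LoopGraph V) {F : Finset (Finset V)}
    {R : V → Finset V} {K : ℕ} (hF : RunningIntersection F) (hFc : F.card ≤ Fintype.card V + 1)
    (hK : ∀ B ∈ F, B.powerset.card ≤ K) (hR : ∀ i ∈ G.plus, R i ∈ F)
    (hadj : ∀ i j, G.graph.Adj i j → i ∈ G.plus → j ∈ R i ∧ j ∉ G.plus)
    (hnode : ∀ j, ∃ B ∈ F, j ∈ B)
    (hedge : ∀ j k, G.graph.Adj j k → ∃ B ∈ F, j ∈ B ∧ k ∈ B) :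
    HasSOCExtendedFormulation G.QP (sizeBound (Fintype.card V) K) := by
  classical
  -- Variables exist only for pairs with `T ⊆ B` (or `T ⊆ R i`) and are extended by zero; using all
  -- subsets of `V` would be exponential.
  set I : Finset (Σ _ : Finset V, Finset V) := F.sigma Finset.powerset with hI
  set J : Finset (Σ _ : V, Finset V) :=
    (Finset.univ.filter (· ∈ G.plus)).sigma fun i => (R i).powerset with hJ
  have hmemI : ∀ B T, (⟨B, T⟩ : Σ _ : Finset V, Finset V) ∈ I ↔ B ∈ F ∧ T ⊆ B := by simp [hI]
  have hmemJ : ∀ i T, (⟨i, T⟩ : Σ _ : V, Finset V) ∈ J ↔ i ∈ G.plus ∧ T ⊆ R i := by simp [hJ]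
  have hIc : I.card ≤ (Fintype.card V + 1) * K := by
    rw [hI, Finset.card_sigma]
    exact (Finset.sum_le_card_nsmul _ _ _ hK).trans (Nat.mul_le_mul_right _ hFc)
  have hJc : J.card ≤ Fintype.card V * K := by
    rw [hJ, Finset.card_sigma]
    exact (Finset.sum_le_card_nsmul _ _ _ fun i hi => hK _ (hR i (Finset.mem_filter.1 hi).2)).trans
      (Nat.mul_le_mul_right _ (Finset.card_le_univ _))
  set e := Fintype.equivFin (I ⊕ J ⊕ J)
  set r := Fintype.card (I ⊕ J ⊕ J) with hr
  set lam : (G.Coord ⊕ Fin r → ℝ) → Finset V → Finset V → ℝ := fun u B T =>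
    if h : ⟨B, T⟩ ∈ I then u (.inr (e (.inl ⟨_, h⟩))) else 0 with hlam
  set y : (G.Coord ⊕ Fin r → ℝ) → V → Finset V → ℝ := fun u i T =>
    if h : ⟨i, T⟩ ∈ J then u (.inr (e (.inr (.inl ⟨_, h⟩)))) else 0 with hy
  set w : (G.Coord ⊕ Fin r → ℝ) → V → Finset V → ℝ := fun u i T =>
    if h : ⟨i, T⟩ ∈ J then u (.inr (e (.inr (.inr ⟨_, h⟩)))) else 0 with hw
  obtain ⟨S, hS, hN⟩ := G.socRep_isLift (z := fun u c => u (.inl c)) (lam := lam) (y := y) (w := w)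
    hFc hK hR (fun c => isLinearMap_proj _)
    (fun B T => by
      simp only [hlam]; split_ifs
      exacts [isLinearMap_proj _, isLinearMap_zero])
    (fun B T => by
      simp only [hy]; split_ifs
      exacts [isLinearMap_proj _, isLinearMap_zero])
    (fun B T => by
      simp only [hw]; split_ifs
      exacts [isLinearMap_proj _, isLinearMap_zero])
  refine ⟨r, S, ⟨convex_socSolutionSet S, Set.Subset.antisymm (convexHull_min ?_ ?_) ?_⟩, ?_⟩
  · intro z hz
    obtain ⟨lam', y', w', h, hl', hy', hw'⟩ :=
      G.exists_isLift F R hR (fun i j h hi => (hadj i j h hi).1) hz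
    set u : G.Coord ⊕ Fin r → ℝ := Sum.elim z fun k => match e.symm k with
      | .inl p => lam' p.1.1 p.1.2
      | .inr (.inl q) => y' q.1.1 q.1.2
      | .inr (.inr q) => w' q.1.1 q.1.2 with hu
    refine ⟨_, (hS u).2 ?_⟩
    have h_lam : lam u = lam' := by
      ext B T
      by_cases hT : (⟨B, T⟩ : Σ _, Finset V) ∈ I
      · simp [hlam, hu, hT]
      · simp only [hlam, dif_neg hT]
        exact (not_imp_comm.1 (hl' B T) (by rwa [← hmemI])).symm
    have h_y : y u = y' := by
      ext i T
      by_cases hT : (⟨i, T⟩ : Σ _, Finset V) ∈ J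
      · simp [hy, hu, hT]
      · simp only [hy, dif_neg hT]
        exact (not_imp_comm.1 (hy' i T) (by rwa [← hmemJ])).symm
    have h_w : w u = w' := by
      ext i T
      by_cases hT : (⟨i, T⟩ : Σ _, Finset V) ∈ J
      · simp [hw, hu, hT]
      · simp only [hw, dif_neg hT]
        exact (not_imp_comm.1 (hw' i T) (by rwa [← hmemJ])).symm
    simp only [h_lam, h_y, h_w]
    exact h
  · rintro x ⟨u, hu⟩ x' ⟨u', hu'⟩ a b ha hb hab
    refine ⟨a • u + b • u', ?_⟩
    convert convex_socSolutionSet S hu hu' ha hb hab using 1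
    ext (i | i) <;> simp
  · rintro z ⟨u, hu⟩
    refine ((hS _).1 hu).mem_QP hF hR hadj hnode hedge (fun B T h => ?_) (fun i T h => ?_)
      (fun i T h => ?_)
    · exact ((hmemI B T).1 (by by_contra hBT; exact h (dif_neg hBT))).2
    · exact ((hmemJ i T).1 (by by_contra hBT; exact h (dif_neg hBT))).2
    · exact ((hmemJ i T).1 (by by_contra hBT; exact h (dif_neg hBT))).2
  · have hcoord := G.card_coord_le
    have hrc : r = I.card + (J.card + J.card) := by simp [hr]
    rw [socSize, Fintype.card_sum, Fintype.card_fin, sizeBound]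
    refine Nat.add_le_add (Nat.add_le_add hcoord ?_) hN
    rw [hrc]
    exact Nat.add_le_add hIc (Nat.add_le_add hJc hJc)

end LoopGraph

/-! ### Logarithmic bounds and the main theorem -/

theorem two_pow_le_of_le_log {m n : ℕ} {c : ℕ} (hn : n ≠ 0) (h : (m : ℝ) ≤ c * Real.log n + 1) :
    2 ^ m ≤ 2 * n ^ c := by
  have hn' : (0 : ℝ) < n := by positivity
  have hlog : 0 ≤ Real.log n := Real.log_natCast_nonneg n
  have h2 : Real.log 2 ≤ 1 := by linarith [Real.log_two_lt_d9]
  have h3 : 0 < Real.log 2 := Real.log_pos one_lt_two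
  have : (2 : ℝ) ^ m ≤ 2 * (n : ℝ) ^ c := by
    rw [← Real.log_le_log_iff (by positivity) (by positivity), Real.log_pow,
      Real.log_mul (by norm_num) (by positivity), Real.log_pow]
    have h4 : 0 ≤ c * Real.log n := by positivity
    nlinarith
  exact_mod_cast this

theorem TreeDecomposition.hasSOCExtendedFormulation_QP {V ι : Type*} [Fintype V] [DecidableEq V]
    [Fintype ι] (G : LoopGraph V) (D : TreeDecomposition G.graph ι)
    (hplus : ∀ i : ι, ∀ u ∈ D.bag i, ∀ v ∈ D.bag i, u ∈ G.plus → v ∈ G.plus → u = v) {K : ℕ}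
    (hK : ∀ i, 2 ^ (D.mergedBag G.plus i).card ≤ K) :
    HasSOCExtendedFormulation G.QP (LoopGraph.sizeBound (Fintype.card V) K) := by
  classical
  obtain ⟨F, hF, hFB, hBF, hFc⟩ := exists_runningIntersection D.isTree (D.mergedBag G.plus)
    fun i j p hp k hk => D.mergedBag_inter_subset G.plus i j p hp k hk
  have hbag : ∀ i v, v ∈ D.bag i → v ∈ D.mergedBag G.plus i := fun i v h =>
    (D.mem_mergedBag G.plus i v).2 (Or.inl h)
  choose i hi using D.exists_mem_bag
  choose P hPF hP using hBF
  -- For a plus node `v`, any bag through `v` will do: its merged bag contains every bag through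
  -- `v`, hence all neighbours.
  refine G.hasSOCExtendedFormulation_QP (R := fun v => P (i v)) hF hFc (fun B hB => ?_)
    (fun v _ => hPF _) (fun u v huv hu => ?_) (fun v => ⟨P (i v), hPF _, hP _ (hbag _ _ (hi v))⟩)
    (fun u v huv => ?_)
  · obtain ⟨j, rfl⟩ := hFB B hB
    rw [Finset.card_powerset]
    exact hK j
  · obtain ⟨j, huj, hvj⟩ := D.exists_edge_bag u v huv
    exact ⟨hP _ ((D.mem_mergedBag G.plus _ v).2 (Or.inr ⟨u, hu, hi u, j, huj, hvj⟩)),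
      fun hv => huv.ne (hplus j u huj v hvj hu hv)⟩
  · obtain ⟨j, huj, hvj⟩ := D.exists_edge_bag u v huv
    exact ⟨P j, hPF j, hP j (hbag j u huj), hP j (hbag j v hvj)⟩

theorem mainTheorem1 (c₁ c₂ : ℝ) :
    ∃ p : Polynomial ℕ, ∀ (V : Type u) [Fintype V] [DecidableEq V] (G : LoopGraph V)
      (ι : Type v) [Fintype ι] (D : TreeDecomposition G.graph ι),
      (∀ i : ι, ∀ u ∈ D.bag i, ∀ v ∈ D.bag i, u ∈ G.plus → v ∈ G.plus → u = v) →
      (D.width : ℝ) ≤ c₁ * Real.log (Fintype.card V) →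
      (∀ v ∈ G.plus, (D.spread v : ℝ) ≤ c₂ * Real.log (Fintype.card V)) →
      HasSOCExtendedFormulation G.QP (p.eval (Fintype.card V)) := by
  obtain ⟨c, hc⟩ := exists_nat_ge (max c₁ c₂)
  obtain ⟨hc₁, hc₂⟩ := max_le_iff.1 hc
  -- The `+ 1` is for empty `V`, where `2 * 0 ^ c` may be 0 but the empty bag still has one subset.
  let q : Polynomial ℕ := 2 * Polynomial.X ^ c + 1
  let n : Polynomial ℕ := Polynomial.X
  refine ⟨2 * n + n ^ 2 + ((n + 1) * q + (n * q + n * q)) +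
    ((n + 1) * (q * 1) + ((n + 1) * 2 + ((n + 1) * ((n + 1) * (q * 2)) + (n * ((n + 1) * 2) +
      (n * (n * ((n + 1) * 2)) + (n * (q * 1) + (n * (q * 1) + (n * (q * 3) + (n * 2 + (n * 2 +
        (n * (n * 2) + n * 1))))))))))), ?_⟩
  intro V _ _ G ι _ D hplus hwidth hspread
  have h := D.hasSOCExtendedFormulation_QP G hplus (K := 2 * Fintype.card V ^ c + 1) fun i => by
    have hlog : 0 ≤ Real.log (Fintype.card V) := Real.log_natCast_nonneg _
    by_cases hn : Fintype.card V = 0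
    · have := Finset.card_le_univ (D.mergedBag G.plus i)
      rw [hn, Nat.le_zero] at this
      rw [this, pow_zero]
      exact Nat.le_add_left _ _
    · refine (two_pow_le_of_le_log hn ?_).trans (Nat.le_succ _)
      rcases D.card_mergedBag_le G.plus hplus i with h | ⟨s, hs, h⟩
      · have h' : ((D.mergedBag G.plus i).card : ℝ) ≤ D.width + 1 := by exact_mod_cast h
        nlinarith
      · have h' : ((D.mergedBag G.plus i).card : ℝ) ≤ D.spread s + 1 := by exact_mod_cast h
        have := hspread s hs
        nlinarith
  simpa [LoopGraph.sizeBound, n, q] using h
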